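/- For $\beta>1$ let $T_\beta:[0,1]\to[0,1]$, $T_\beta(y)=\beta y-\lfloor \beta y\rfloor$, be the $\beta$-transformation. Let $x:(1,+\infty)\to[0,1]$ be a Lipschitz continuous function and let $\{\ell_n\}_{n\ge 1}$ be a sequence of positive integers such that $\ell_n\to\infty$ as $n\to\infty$. Put $$\widetilde E\big(\{\ell_n\}_{n\ge1},x\big)=\Big\{\beta>1:\ |T_\beta^n 1-x(\beta)|<\beta^{-\ell_n}\ \text{for infinitely many } n\in\mathbb N\Big\}.$$ Then the Hausdorff dimension of this set is $$\dim_{\mathsf H}\widetilde E\big(\{\ell_n\}_{n\ge1},x\big)=\frac{1}{1+\alpha},\qquad\text{where }\ \alpha=\liminf_{n\to\infty}\frac{\ell_n}{n}\in[0,+\infty],$$ and $\frac1{1+\infty}$ is read as $0$. -/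

import Mathlib

open Set Filter Topology
open scoped NNReal ENNReal

/-- The `β`-transformation `T_β x = β x - ⌊β x⌋` (so that `T_β 0 = 0`). It is written on all of `ℝ`;
it maps `[0, 1]` into itself, and `T_β 1 = β - ⌊β⌋`. -/
noncomputable def betaMap (β x : ℝ) : ℝ := β * x - (⌊β * x⌋ : ℝ)

/-- The set of parameters `β > 1` such that `|T_β^n 1 - x(β)| < β^(-ℓ_n)` for infinitely many
`n ≥ 1`. Only the values of `x` on `(1, ∞)` and of `ℓ` on `{1, 2, …}` matter. -/
def approxParams (ℓ : ℕ → ℕ) (x : ℝ → ℝ) : Set ℝ :=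
  {β : ℝ | 1 < β ∧
    {n : ℕ | 1 ≤ n ∧ |(betaMap β)^[n] 1 - x β| < β ^ (-(ℓ n : ℤ))}.Infinite}

/-!
Write `α = liminf ℓ n / n`. Both bounds rest on one identity: if `T_β^k 1` and `T_γ^k 1` have the
same next digit, then `T_γ^(k+1) 1 - T_β^(k+1) 1 = γ (T_γ^k 1 - T_β^k 1) + (γ - β) T_β^k 1`. So on a
set of parameters sharing the first `n` digits of the expansion of `1`, the map `β ↦ T_β^n 1` is
increasing with slope comparable to `β ^ n`, which for large `n` dwarfs the Lipschitz constant of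
the target `x`.

Upper bound. In a short window `[b₀, b₁]`, the parameters with `|T_β^n 1 - x β| < β ^ (-ℓ n)` and a
given digit word of length `n` lie in an interval of length at most a constant times
`b₀ ^ (-(n + ℓ n))` (`pow_mul_sub_le_of_digits_eq`). The words are counted by reading all of them in
one base `B > b₁`: the resulting numbers lie in `[0, 1)` and are separated by a constant times
`B ^ (-n)` (`le_abs_rebasedValue_sub`), so there are at most about `B ^ n` words. Summing over `n`
and letting the window shrink to a point gives `1 / (1 + α)` (`dimH_approxParams_le`).

Lower bound. The dimension is already reached on windows `[b, b + 1]` with `b = 2 m` a large even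
integer. A branch is a parameter interval on which `β ↦ T_β^n 1` is given by one continuous
increasing function; it is full if the image is all of `[0, 1]`. A full branch has full children for
the digits `0, …, b - 1`, and every part of a branch whose image has length `(N + 1) b⁻ᴺ` contains a
full branch `N` levels further down (`IsBranch.exists_isFullBranch`); applied to the part where the
orbit is close to the target, this gives full branches of approximating parameters at the cost of
about `ℓ n` further levels (`IsFullBranch.exists_isFullBranch_near`). A Cantor set is built from
free even digits, which keep different branches apart, interrupted by such blocks at times `n` with
`ℓ n ≈ α n`. The times are so sparse that the level stays below `A i + 1` after `i` free digits,
for a given `A > 1 + α`. Reading the free digits in base `m` then maps the Cantor set onto `[0, 1)`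
with Hölder exponent close to `1 / (1 + α)` as `m → ∞` and `A → 1 + α`
(`exists_le_dimH_of_scheme`, `le_dimH_approxParams`).
-/

/-! ### The orbit of `1` and its dependence on the parameter -/

theorem betaMap_nonneg (β y : ℝ) : 0 ≤ betaMap β y :=
  sub_nonneg.2 (Int.floor_le _)

theorem betaMap_lt_one (β y : ℝ) : betaMap β y < 1 := by
  unfold betaMap
  linarith [Int.lt_floor_add_one (β * y)]

theorem betaMap_iterate_mem (β : ℝ) (n : ℕ) {y : ℝ} (hy : y ∈ Icc (0 : ℝ) 1) :
    (betaMap β)^[n] y ∈ Icc (0 : ℝ) 1 := by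
  cases n with
  | zero => simpa using hy
  | succ n =>
    rw [Function.iterate_succ_apply']
    exact ⟨betaMap_nonneg _ _, (betaMap_lt_one _ _).le⟩

/-- On a set of parameters sharing the first `n` digits of the expansion of `1`, the map
`β ↦ T_β^n 1` expands by at least `γ ^ (n - 1)`, because
`T_γ^(k+1) 1 - T_β^(k+1) 1 = γ (T_γ^k 1 - T_β^k 1) + (γ - β) T_β^k 1`. -/
theorem pow_mul_sub_le_of_digits_eq {β γ : ℝ} (hβ : 0 < β) (hβγ : β ≤ γ) (n : ℕ)
    (h : ∀ k ≤ n, ⌊β * (betaMap β)^[k] 1⌋ = ⌊γ * (betaMap γ)^[k] 1⌋) :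
    γ ^ n * (γ - β) ≤ (betaMap γ)^[n + 1] 1 - (betaMap β)^[n + 1] 1 := by
  induction n with
  | zero =>
    have := h 0 le_rfl
    simp only [Function.iterate_zero, id, mul_one] at this
    simp only [zero_add, Function.iterate_one, betaMap, mul_one, this, pow_zero, one_mul]
    linarith
  | succ n ih =>
    have ih := ih fun k hk => h k (by omega)
    have h0 := (betaMap_iterate_mem β (n + 1) (y := 1) (by simp)).1
    have hd := h (n + 1) le_rfl
    rw [Function.iterate_succ_apply' _ (n + 1), Function.iterate_succ_apply' _ (n + 1)]
    generalize (betaMap β)^[n + 1] 1 = u at *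
    generalize (betaMap γ)^[n + 1] 1 = v at *
    unfold betaMap
    rw [hd, pow_succ]
    nlinarith [mul_le_mul_of_nonneg_left ih (hβ.le.trans hβγ),
      mul_nonneg (sub_nonneg.2 hβγ) h0]

/-! ### Counting digit words -/

/-- The first `n` digits of the `β`-expansion of `y`, read in another base `B`: the number
`∑ i < n, d_i B^(-(i+1))`, where `d_i = ⌊β T_β^i y⌋`. -/
noncomputable def rebasedValue (β B : ℝ) : ℕ → ℝ → ℝ
  | 0, _ => 0
  | n + 1, y => ((⌊β * y⌋ : ℝ) + rebasedValue β B n (betaMap β y)) / B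

theorem rebasedValue_nonneg {β B : ℝ} (hβ : 0 ≤ β) (hB : 0 ≤ B) (n : ℕ) {y : ℝ} (hy : 0 ≤ y) :
    0 ≤ rebasedValue β B n y := by
  induction n generalizing y with
  | zero => simp [rebasedValue]
  | succ n ih =>
    have h1 : (0 : ℝ) ≤ ⌊β * y⌋ := by
      exact_mod_cast Int.floor_nonneg.2 (mul_nonneg hβ hy)
    exact div_nonneg (add_nonneg h1 (ih (betaMap_nonneg _ _))) hB

/-- Reading digits in a larger base shrinks the value by at least the ratio of the bases. -/
theorem rebasedValue_le {β B : ℝ} (hβ : 0 ≤ β) (hB : 0 < B) (hβB : β ≤ B) (n : ℕ) {y : ℝ}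
    (hy : 0 ≤ y) : rebasedValue β B n y ≤ β / B * y := by
  induction n generalizing y with
  | zero => simp only [rebasedValue]; positivity
  | succ n ih =>
    have h1 := ih (betaMap_nonneg β y)
    have h2 : β / B * betaMap β y ≤ betaMap β y :=
      mul_le_of_le_one_left (betaMap_nonneg _ _) ((div_le_one hB).2 hβB)
    have h3 : betaMap β y = β * y - ⌊β * y⌋ := rfl
    simp only [rebasedValue]
    rw [div_mul_eq_mul_div]
    gcongr
    linarith

/-- If the digits of two expansions differ in one of the first `n` places, their readings in a
base `B` strictly above both parameters are at distance at least `(1 - b₁ / B) B⁻ⁿ`: at the first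
difference the digits differ by `1`, while the tails are at most `b₁ / B`. -/
theorem le_abs_rebasedValue_sub {β γ b₁ B : ℝ} (hβ : 0 ≤ β) (hγ : 0 ≤ γ) (hβ₁ : β ≤ b₁)
    (hγ₁ : γ ≤ b₁) (hB : 1 ≤ B) (hb₁ : b₁ ≤ B) (n : ℕ) {y z : ℝ} (hy : y ∈ Icc (0 : ℝ) 1)
    (hz : z ∈ Icc (0 : ℝ) 1)
    (h : ∃ k < n, ⌊β * (betaMap β)^[k] y⌋ ≠ ⌊γ * (betaMap γ)^[k] z⌋) :
    (1 - b₁ / B) * (B ^ n)⁻¹ ≤ |rebasedValue β B n y - rebasedValue γ B n z| := by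
  have hB0 : 0 < B := by linarith
  have hmem : ∀ (δ w : ℝ), betaMap δ w ∈ Icc (0 : ℝ) 1 := fun δ w =>
    ⟨betaMap_nonneg _ _, (betaMap_lt_one _ _).le⟩
  have htail : ∀ (δ w : ℝ) (m : ℕ), 0 ≤ δ → δ ≤ b₁ →
      rebasedValue δ B m (betaMap δ w) ∈ Icc 0 (b₁ / B) := fun δ w m h0 h1 =>
    ⟨rebasedValue_nonneg h0 hB0.le m (hmem δ w).1,
      (rebasedValue_le h0 hB0 (h1.trans hb₁) m (hmem δ w).1).trans <|
        (mul_le_of_le_one_right (by positivity) (hmem δ w).2).trans (by gcongr)⟩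
  have hη : 0 ≤ 1 - b₁ / B := sub_nonneg.2 ((div_le_one hB0).2 hb₁)
  induction n generalizing y z with
  | zero => obtain ⟨k, hk, _⟩ := h; omega
  | succ n ih =>
    simp only [rebasedValue]
    rw [← sub_div, abs_div, abs_of_pos hB0, le_div_iff₀ hB0, pow_succ, mul_inv, mul_assoc,
      mul_assoc, inv_mul_cancel₀ hB0.ne', mul_one]
    by_cases hd : ⌊β * y⌋ = ⌊γ * z⌋
    · rw [hd, add_sub_add_left_eq_sub]
      refine ih (hmem _ _) (hmem _ _) ?_
      obtain ⟨k, hk, hne⟩ := h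
      cases k with
      | zero => exact absurd hd (by simpa using hne)
      | succ k => exact ⟨k, by omega, by simpa using hne⟩
    · have hle : (1 - b₁ / B) * (B ^ n)⁻¹ ≤ 1 - b₁ / B :=
        mul_le_of_le_one_right hη (inv_le_one_of_one_le₀ (one_le_pow₀ hB))
      refine hle.trans ?_
      have h1 := htail β y n hβ hβ₁
      have h2 := htail γ z n hγ hγ₁
      rcases lt_or_gt_of_ne hd with hlt | hlt
      · have : (⌊β * y⌋ : ℝ) + 1 ≤ ⌊γ * z⌋ := by exact_mod_cast hlt
        rw [abs_sub_comm]
        exact le_trans (by linarith [h1.2, h2.1]) (le_abs_self _)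
      · have : (⌊γ * z⌋ : ℝ) + 1 ≤ ⌊β * y⌋ := by exact_mod_cast hlt
        exact le_trans (by linarith [h1.1, h2.2]) (le_abs_self _)

/-! ### The upper bound -/

/-- A covering bound for the dimension of a limsup set: the tails of the coverings are coverings
by arbitrarily small sets with arbitrarily small total `d`-dimensional size. -/
theorem dimH_le_of_frequently_mem {S : Set ℝ} {E : ℕ → Set ℝ} {M : ℕ → ℕ} {ρ : ℕ → ℝ} {d : ℝ≥0}
    (hρ : Antitone ρ) (hρ0 : Tendsto ρ atTop (𝓝 0))
    (hsum : Summable fun n => (M n : ℝ) * ρ n ^ (d : ℝ))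
    (hcov : ∀ᶠ n in atTop, ∃ t : Fin (M n) → Set ℝ, E n ⊆ ⋃ i, t i ∧
      ∀ i, ∀ β ∈ t i, ∀ γ ∈ t i, |β - γ| ≤ ρ n)
    (hS : ∀ β ∈ S, ∃ᶠ n in atTop, β ∈ E n) : dimH S ≤ d := by
  have hρnn : ∀ n, 0 ≤ ρ n := fun n => hρ.le_of_tendsto hρ0 n
  have hcov' : ∀ n, ∃ t : Fin (M n) → Set ℝ, (∀ i, ∀ β ∈ t i, ∀ γ ∈ t i, |β - γ| ≤ ρ n) ∧
      ((∃ t : Fin (M n) → Set ℝ, E n ⊆ ⋃ i, t i ∧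
        ∀ i, ∀ β ∈ t i, ∀ γ ∈ t i, |β - γ| ≤ ρ n) → E n ⊆ ⋃ i, t i) := by
    intro n
    by_cases h : ∃ t : Fin (M n) → Set ℝ, E n ⊆ ⋃ i, t i ∧
        ∀ i, ∀ β ∈ t i, ∀ γ ∈ t i, |β - γ| ≤ ρ n
    · obtain ⟨t, h1, h2⟩ := h
      exact ⟨t, h2, fun _ => h1⟩
    · exact ⟨fun _ => ∅, by simp, fun h' => absurd h' h⟩
  choose t ht htE using hcov'
  have hdiam : ∀ n i, Metric.ediam (t n i) ≤ ENNReal.ofReal (ρ n) := by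
    intro n i
    refine Metric.ediam_le fun β hβ γ hγ => ?_
    rw [edist_dist, Real.dist_eq]
    exact ENNReal.ofReal_le_ofReal (ht n i β hβ γ hγ)
  set f : ℕ → ℝ≥0∞ := fun n => (M n : ℝ≥0∞) * ENNReal.ofReal (ρ n) ^ (d : ℝ) with hf
  have hfsum : ∑' n, f n ≠ ∞ := by
    have : ∀ n, f n = ENNReal.ofReal ((M n : ℝ) * ρ n ^ (d : ℝ)) := by
      intro n
      rw [ENNReal.ofReal_mul (by positivity), ENNReal.ofReal_natCast,
        ← ENNReal.ofReal_rpow_of_nonneg (hρnn n) d.coe_nonneg]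
    simp_rw [this]
    exact hsum.tsum_ofReal_ne_top
  have htend := ENNReal.tendsto_sum_nat_add f hfsum
  have key : MeasureTheory.Measure.hausdorffMeasure (d : ℝ) S ≤
      liminf (fun N => ∑' p : (Σ n : ℕ, Fin (M (n + N))),
        Metric.ediam (t (p.1 + N) p.2) ^ (d : ℝ)) atTop := by
    refine MeasureTheory.Measure.hausdorffMeasure_le_liminf_tsum (d : ℝ) S
      (ι := fun N => Σ n : ℕ, Fin (M (n + N)))
      (fun N => ENNReal.ofReal (ρ N)) ?_ (fun N p => t (p.1 + N) p.2) ?_ ?_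
    · simpa using ENNReal.tendsto_ofReal hρ0
    · refine Eventually.of_forall fun N p => (hdiam _ _).trans ?_
      exact ENNReal.ofReal_le_ofReal (hρ (by omega))
    · obtain ⟨N₀, hN₀⟩ := eventually_atTop.1 hcov
      filter_upwards [eventually_ge_atTop N₀] with N hN β hβ
      obtain ⟨n, hn, hβn⟩ := (frequently_atTop.1 (hS β hβ)) N
      obtain ⟨k, rfl⟩ := Nat.exists_eq_add_of_le' hn
      obtain ⟨i, hi⟩ := mem_iUnion.1 (htE (k + N) (hN₀ _ (by omega)) hβn)
      exact mem_iUnion.2 ⟨⟨k, i⟩, hi⟩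
  have hle : liminf (fun N => ∑' p : (Σ n : ℕ, Fin (M (n + N))),
        Metric.ediam (t (p.1 + N) p.2) ^ (d : ℝ)) atTop ≤
      liminf (fun N => ∑' k, f (k + N)) atTop := by
    refine liminf_le_liminf (Eventually.of_forall fun N => ?_)
    rw [ENNReal.tsum_sigma
      fun (k : ℕ) (i : Fin (M (k + N))) => Metric.ediam (t (k + N) i) ^ (d : ℝ)]
    refine ENNReal.tsum_le_tsum fun k => ?_
    calc ∑' i : Fin (M (k + N)), Metric.ediam (t (k + N) i) ^ (d : ℝ)
        ≤ ∑' _ : Fin (M (k + N)), ENNReal.ofReal (ρ (k + N)) ^ (d : ℝ) :=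
          ENNReal.tsum_le_tsum fun i => ENNReal.rpow_le_rpow (hdiam _ _) d.2
      _ = f (k + N) := by simp [hf]
  rw [htend.liminf_eq] at hle
  refine dimH_le_of_hausdorffMeasure_ne_top ?_
  rw [le_antisymm (key.trans hle) bot_le]
  simp

/-- The part of the parameter set in a short window `[b₀, b₁]`. There are about `B ^ n` digit words
of length `n`, and each contributes an interval of length about `b₀ ^ (-(1 + a) n)`. -/
theorem dimH_approxParams_inter_Icc_le {x : ℝ → ℝ} {L : ℝ≥0} (hx : LipschitzOnWith L x (Ioi 1))
    {ℓ : ℕ → ℕ} {a b₀ b₁ B : ℝ} {d : ℝ≥0} (ha : 0 ≤ a) (hℓ : ∀ᶠ n : ℕ in atTop, a * n ≤ ℓ n)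
    (hb₀ : 1 < b₀) (hb₁ : b₀ ≤ b₁) (hB : b₁ < B) (hBd : B < b₀ ^ ((1 + a) * d)) :
    dimH (approxParams ℓ x ∩ Icc b₀ b₁) ≤ d := by
  have hb0 : 0 < b₀ := by linarith
  have hB0 : 0 < B := by linarith
  set q : ℝ := b₀ ^ (-(1 + a)) with hq
  have hq0 : 0 < q := Real.rpow_pos_of_pos hb0 _
  have hq1 : q < 1 := Real.rpow_lt_one_of_one_lt_of_neg hb₀ (by linarith)
  have hBq : B * q ^ (d : ℝ) < 1 := by
    rw [hq, ← Real.rpow_mul hb0.le, neg_mul, Real.rpow_neg hb0.le, ← div_eq_mul_inv,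
      div_lt_one (Real.rpow_pos_of_pos hb0 _)]
    exact hBd
  set η : ℝ := 1 - b₁ / B with hη
  have hη0 : 0 < η := sub_pos.2 ((div_lt_one hB0).2 hB)
  set M : ℕ → ℕ := fun n => ⌊B ^ n / η⌋₊ + 1 with hM
  set E : ℕ → Set ℝ := fun n =>
    {β | β ∈ Icc b₀ b₁ ∧ |(betaMap β)^[n] 1 - x β| < β ^ (-(ℓ n : ℤ))} with hE
  refine dimH_le_of_frequently_mem (E := E) (M := M) (ρ := fun n => 4 * b₀ * q ^ n) ?_ ?_ ?_ ?_ ?_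
  · intro m n hmn
    exact mul_le_mul_of_nonneg_left (pow_le_pow_of_le_one hq0.le hq1.le hmn) (by positivity)
  · simpa using (tendsto_pow_atTop_nhds_zero_of_lt_one hq0.le hq1).const_mul (4 * b₀)
  · refine Summable.of_nonneg_of_le (fun n => by positivity) (fun n => ?_)
      ((summable_geometric_of_lt_one (by positivity) hBq).mul_left
        ((1 / η + 1) * (4 * b₀) ^ (d : ℝ)))
    have h1 : (M n : ℝ) ≤ (1 / η + 1) * B ^ n := by
      have h2 : (⌊B ^ n / η⌋₊ : ℝ) ≤ B ^ n / η := Nat.floor_le (by positivity)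
      have h3 : 1 ≤ B ^ n := one_le_pow₀ (by linarith)
      simp only [hM, Nat.cast_add, Nat.cast_one]
      rw [add_mul, one_div, one_mul, inv_mul_eq_div]
      linarith
    rw [Real.mul_rpow (by positivity) (by positivity), mul_pow, ← Real.rpow_natCast q n,
      ← Real.rpow_mul hq0.le, mul_comm (n : ℝ), Real.rpow_mul hq0.le, Real.rpow_natCast]
    calc (M n : ℝ) * ((4 * b₀) ^ (d : ℝ) * (q ^ (d : ℝ)) ^ n)
        ≤ (1 / η + 1) * B ^ n * ((4 * b₀) ^ (d : ℝ) * (q ^ (d : ℝ)) ^ n) := by gcongr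
      _ = _ := by ring
  · have hlarge : ∀ᶠ n : ℕ in atTop, 2 * (L : ℝ) ≤ b₀ ^ n :=
      (tendsto_pow_atTop_atTop_of_one_lt hb₀).eventually_ge_atTop _
    obtain ⟨N₀, hN₀⟩ := eventually_atTop.1 hlarge
    filter_upwards [hℓ, eventually_ge_atTop (N₀ + 1)] with n hℓn hn
    obtain ⟨k, rfl⟩ := Nat.exists_eq_add_of_le' (show 1 ≤ n by omega)
    have hLk : 2 * (L : ℝ) ≤ b₀ ^ k := hN₀ k (by omega)
    set n := k + 1 with hn'
    set V : ℝ → ℝ := fun β => rebasedValue β B n 1 with hV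
    have hMpos : (0 : ℝ) < M n := by simp only [hM]; positivity
    have hVmem : ∀ β ∈ E n, 0 ≤ V β ∧ V β < 1 := by
      intro β hβ
      have hβ0 : 0 ≤ β := hb0.le.trans hβ.1.1
      refine ⟨rebasedValue_nonneg hβ0 hB0.le n zero_le_one, ?_⟩
      refine (rebasedValue_le hβ0 hB0 (hβ.1.2.trans hB.le) n zero_le_one).trans_lt ?_
      rw [mul_one, div_lt_one hB0]
      exact hβ.1.2.trans_lt hB
    refine ⟨fun i => {β ∈ E n | ⌊V β * M n⌋₊ = (i : ℕ)}, fun β hβ => ?_, fun i β hβ γ hγ => ?_⟩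
    · have h := hVmem β hβ
      have hlt : ⌊V β * M n⌋₊ < M n := by
        rw [Nat.floor_lt (mul_nonneg h.1 hMpos.le)]
        exact mul_lt_of_lt_one_left hMpos h.2
      exact mem_iUnion.2 ⟨⟨_, hlt⟩, hβ, rfl⟩
    · -- Parameters in one cell of the `V`-grid have the same digits.
      have hclose : |V β - V γ| < η * (B ^ n)⁻¹ := by
        have h1 := hVmem β hβ.1
        have h2 := hVmem γ hγ.1
        have a1 := Nat.floor_le (mul_nonneg h1.1 hMpos.le)
        have a2 := Nat.lt_floor_add_one (V β * M n)
        have a3 := Nat.floor_le (mul_nonneg h2.1 hMpos.le)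
        have a4 := Nat.lt_floor_add_one (V γ * M n)
        rw [hβ.2] at a1 a2
        rw [hγ.2] at a3 a4
        have h3 : |V β - V γ| * M n < 1 := by
          rw [← abs_of_pos hMpos, ← abs_mul, sub_mul, abs_lt]
          constructor <;> linarith
        have h4 : B ^ n / η < M n := by
          simp only [hM]
          exact_mod_cast Nat.lt_floor_add_one (B ^ n / η)
        have h5 : η * (B ^ n)⁻¹ = (B ^ n / η)⁻¹ := by rw [inv_div, div_eq_mul_inv]
        rw [h5]
        have h6 : |V β - V γ| < (M n : ℝ)⁻¹ := by
          rwa [← one_div, lt_div_iff₀ hMpos]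
        exact h6.trans (inv_strictAnti₀ (by positivity) h4)
      have hdigits : ∀ β ∈ E n, ∀ γ ∈ E n, |V β - V γ| < η * (B ^ n)⁻¹ →
          ∀ j < n, ⌊β * (betaMap β)^[j] 1⌋ = ⌊γ * (betaMap γ)^[j] 1⌋ := by
        intro β hβ γ hγ hlt
        by_contra! hne
        exact absurd (le_abs_rebasedValue_sub (hb0.le.trans hβ.1.1) (hb0.le.trans hγ.1.1) hβ.1.2
          hγ.1.2 (by linarith) hB.le n (by simp) (by simp) hne) (not_le.2 hlt)
      -- On parameters with common digits, expansion beats the Lipschitz target.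
      have main : ∀ β ∈ E n, ∀ γ ∈ E n, |V β - V γ| < η * (B ^ n)⁻¹ → β ≤ γ →
          |β - γ| ≤ 4 * b₀ * q ^ n := by
        intro β hβ γ hγ hlt hle
        have hexp := pow_mul_sub_le_of_digits_eq (hb0.trans_le hβ.1.1) hle k
          fun j hj => hdigits β hβ γ hγ hlt j (by omega)
        have hLip : |x γ - x β| ≤ L * (γ - β) := by
          have := hx.dist_le_mul γ (hb₀.trans_le hγ.1.1) β (hb₀.trans_le hβ.1.1)
          rwa [Real.dist_eq, Real.dist_eq, abs_of_nonneg (sub_nonneg.2 hle)] at this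
        have hpow : ∀ δ ∈ E n, δ ^ (-(ℓ n : ℤ)) ≤ (b₀ ^ ℓ n)⁻¹ := by
          intro δ hδ
          rw [zpow_neg, zpow_natCast]
          exact inv_anti₀ (by positivity) (pow_le_pow_left₀ hb0.le hδ.1.1 _)
        have e1 := abs_lt.1 (hβ.2.trans_le (hpow β hβ))
        have e2 := abs_lt.1 (hγ.2.trans_le (hpow γ hγ))
        have e3 := abs_le.1 hLip
        have e4 : b₀ ^ k * (γ - β) ≤ γ ^ k * (γ - β) :=
          mul_le_mul_of_nonneg_right (pow_le_pow_left₀ hb0.le hγ.1.1 _) (sub_nonneg.2 hle)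
        have e5 : b₀ ^ k * (γ - β) ≤ 4 * (b₀ ^ ℓ n)⁻¹ := by
          nlinarith [mul_le_mul_of_nonneg_right hLk (sub_nonneg.2 hle), e1.1, e1.2, e2.1, e2.2]
        have e6 : (b₀ ^ k)⁻¹ * (b₀ ^ ℓ n)⁻¹ ≤ b₀ * q ^ n := by
          have h1 : (b₀ ^ k)⁻¹ = b₀ * b₀ ^ (-(n : ℝ)) := by
            rw [Real.rpow_neg hb0.le, Real.rpow_natCast, hn', pow_succ]
            field_simp
          have h2 : (b₀ ^ ℓ n)⁻¹ = b₀ ^ (-(ℓ n : ℝ)) := by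
            rw [Real.rpow_neg hb0.le, Real.rpow_natCast]
          rw [h1, h2, mul_assoc, ← Real.rpow_add hb0, hq, ← Real.rpow_natCast,
            ← Real.rpow_mul hb0.le]
          gcongr
          · exact hb₀.le
          · linarith
        rw [abs_sub_comm, abs_of_nonneg (sub_nonneg.2 hle)]
        calc γ - β = (b₀ ^ k)⁻¹ * (b₀ ^ k * (γ - β)) := by field_simp
          _ ≤ (b₀ ^ k)⁻¹ * (4 * (b₀ ^ ℓ n)⁻¹) := by gcongr
          _ ≤ 4 * b₀ * q ^ n := by linarith
      rcases le_total β γ with h | h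
      · exact main β hβ.1 γ hγ.1 hclose h
      · rw [abs_sub_comm]
        exact main γ hγ.1 β hβ.1 (by rwa [abs_sub_comm]) h
  · rintro β ⟨⟨_, hβ⟩, hβI⟩
    rw [Nat.frequently_atTop_iff_infinite]
    exact hβ.mono fun n hn => ⟨hβI, hn.2⟩

/-- The upper bound: near each parameter the window estimate applies with constants that lose
arbitrarily little. -/
theorem dimH_approxParams_le {x : ℝ → ℝ} {L : ℝ≥0} (hx : LipschitzOnWith L x (Ioi 1)) (ℓ : ℕ → ℕ) :
    dimH (approxParams ℓ x) ≤
      1 / (1 + liminf (fun n : ℕ => (ℓ n : ℝ≥0∞) / (n : ℝ≥0∞)) atTop) := by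
  set α := liminf (fun n : ℕ => (ℓ n : ℝ≥0∞) / (n : ℝ≥0∞)) atTop with hα
  refine le_of_forall_gt_imp_ge_of_dense fun d hd => ?_
  by_contra! hlt
  have hdtop : d ≠ ∞ := hlt.ne_top
  lift d to ℝ≥0 using hdtop
  -- A real exponent `a` below `α` (or equal to `0`) with `1 < (1 + a) d`.
  obtain ⟨a, had, haev⟩ : ∃ a : ℝ≥0, 1 < (1 + a) * d ∧ ∀ᶠ n : ℕ in atTop, (a : ℝ) * n ≤ ℓ n := by
    have hd0 : d ≠ 0 := by
      rintro rfl
      simp at hd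
    have h1 : 1 / (d : ℝ≥0∞) < 1 + α := by
      rw [ENNReal.div_lt_iff (by simp) (by simp)] at hd ⊢
      rwa [mul_comm]
    have hd' : (1 / d : ℝ≥0) < 1 + α := by
      rwa [ENNReal.coe_div hd0, ENNReal.coe_one]
    by_cases hd1 : 1 < d
    · exact ⟨0, by simpa using hd1, by simp⟩
    · have hd1' : 1 ≤ 1 / d := by
        rw [le_div_iff₀ (pos_iff_ne_zero.2 hd0)]
        simpa using not_lt.1 hd1
      have h2 : ((1 / d - 1 : ℝ≥0) : ℝ≥0∞) < α := by
        rw [ENNReal.coe_sub, ENNReal.coe_one]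
        exact ENNReal.sub_lt_of_lt_add (by exact_mod_cast hd1') (by rwa [add_comm] at hd')
      obtain ⟨a, ha1, ha2⟩ := ENNReal.lt_iff_exists_nnreal_btwn.1 h2
      refine ⟨a, ?_, ?_⟩
      · have h3 : 1 / d - 1 < a := by exact_mod_cast ha1
        have h4 : 1 / d < 1 + a := by rwa [tsub_lt_iff_left hd1'] at h3
        rwa [div_lt_iff₀ (pos_iff_ne_zero.2 hd0)] at h4
      · filter_upwards [eventually_lt_of_lt_liminf ha2, eventually_gt_atTop 0] with n hn hn0
        have hn' : (n : ℝ≥0∞) ≠ 0 := by exact_mod_cast hn0.ne'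
        rw [ENNReal.lt_div_iff_mul_lt (Or.inl hn') (Or.inl (by simp))] at hn
        have : (a * n : ℝ≥0) < (ℓ n : ℝ≥0) := by exact_mod_cast hn
        exact_mod_cast this.le
  obtain ⟨β, hβ, hβd⟩ := exists_mem_nhdsWithin_lt_dimH_of_lt_dimH hlt
  have hβ1 : 1 < β := hβ.1
  have had' : (1 : ℝ) < (1 + a) * d := by exact_mod_cast had
  have hβ2 : β < β ^ ((1 + a : ℝ) * d) := by
    simpa using (Real.rpow_lt_rpow_left_iff hβ1).2 had'
  obtain ⟨B, hB1, hB2⟩ := exists_between hβ2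
  obtain ⟨b₁, hb1, hb2⟩ := exists_between hB1
  have hcont : ContinuousAt (fun t : ℝ => t ^ ((1 + a : ℝ) * d)) β :=
    Real.continuousAt_rpow_const _ _ (Or.inl (by linarith))
  have hev : ∀ᶠ t in 𝓝[<] β, 1 < t ∧ B < t ^ ((1 + a : ℝ) * d) := by
    refine (((eventually_gt_nhds hβ1).and (hcont.eventually (eventually_gt_nhds hB2)))).filter_mono
      nhdsWithin_le_nhds
  obtain ⟨b₀, ⟨hb0, hb0'⟩, hb0β⟩ := (hev.and self_mem_nhdsWithin).exists
  have hb0β : b₀ < β := hb0β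
  refine absurd (dimH_approxParams_inter_Icc_le hx a.2 haev hb0 (hb0β.trans hb1).le hb2 hb0')
    (not_le.2 (hβd _ ?_))
  exact inter_mem_nhdsWithin _ (Icc_mem_nhds hb0β hb1)

/-! ### Branches of the orbit of `1` as a function of the parameter -/

/-- `IsBranch b n s t F`: on the parameter interval `[s, t) ⊆ [b, b + 1)` the orbit point
`T_β^n 1` equals `F β`, where `F` extends continuously to `[s, t]`, has values in `[0, 1]`, and
is increasing with slopes between `b ^ (n - 1)` and `(b + 1) ^ n - 1`. The lower slope bound is
multiplied by `b`, which avoids a subtraction in the exponent. -/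
structure IsBranch (b n : ℕ) (s t : ℝ) (F : ℝ → ℝ) : Prop where
  le_left : (b : ℝ) ≤ s
  lt : s < t
  right_le : t ≤ b + 1
  continuousOn : ContinuousOn F (Icc s t)
  orbit : ∀ β ∈ Ico s t, (betaMap β)^[n] 1 = F β
  nonneg_left : 0 ≤ F s
  right_le_one : F t ≤ 1
  expands : ∀ β ∈ Icc s t, ∀ γ ∈ Icc s t, β ≤ γ → (b : ℝ) ^ n * (γ - β) ≤ b * (F γ - F β)
  sub_le : ∀ β ∈ Icc s t, ∀ γ ∈ Icc s t, β ≤ γ → F γ - F β ≤ (((b : ℝ) + 1) ^ n - 1) * (γ - β)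

/-- A branch is full if it maps onto `[0, 1]`. -/
def IsFullBranch (b n : ℕ) (s t : ℝ) (F : ℝ → ℝ) : Prop :=
  IsBranch b n s t F ∧ F s = 0 ∧ F t = 1

theorem isFullBranch_one {b : ℕ} (hb : 0 < b) :
    IsFullBranch b 1 b (b + 1) (fun β => β - b) := by
  refine ⟨⟨le_rfl, by linarith, le_rfl, by fun_prop, ?_, by simp, by simp, ?_, ?_⟩, by simp,
    by simp⟩
  · intro β hβ
    have : ⌊β⌋ = (b : ℤ) := Int.floor_eq_iff.2 ⟨by exact_mod_cast hβ.1, by exact_mod_cast hβ.2⟩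
    simp [betaMap, this]
  · intro β _ γ _ _
    simp
  · intro β _ γ _ h
    have : (1 : ℝ) ≤ b := by exact_mod_cast hb
    nlinarith

namespace IsBranch

variable {b n : ℕ} {s t : ℝ} {F : ℝ → ℝ}

theorem left_mem (h : IsBranch b n s t F) : s ∈ Icc s t := ⟨le_rfl, h.lt.le⟩

theorem right_mem (h : IsBranch b n s t F) : t ∈ Icc s t := ⟨h.lt.le, le_rfl⟩

theorem strictMonoOn (hb : 0 < b) (h : IsBranch b n s t F) : StrictMonoOn F (Icc s t) := by
  intro β hβ γ hγ hlt
  have h1 := h.expands β hβ γ hγ hlt.le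
  have hb' : (0 : ℝ) < b := by exact_mod_cast hb
  have h2 : 0 < (b : ℝ) ^ n * (γ - β) := mul_pos (pow_pos hb' n) (sub_pos.2 hlt)
  exact sub_pos.1 ((mul_pos_iff_of_pos_left hb').1 (h2.trans_le h1))

theorem mem_Icc (hb : 0 < b) (h : IsBranch b n s t F) {β : ℝ} (hβ : β ∈ Icc s t) :
    F β ∈ Icc (0 : ℝ) 1 :=
  ⟨h.nonneg_left.trans ((h.strictMonoOn hb).monotoneOn h.left_mem hβ hβ.1),
    ((h.strictMonoOn hb).monotoneOn hβ h.right_mem hβ.2).trans h.right_le_one⟩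

theorem continuousOn_mul (h : IsBranch b n s t F) :
    ContinuousOn (fun β => β * F β) (Icc s t) :=
  continuousOn_id.mul h.continuousOn

theorem mul_sub_le_mul (hb : 0 < b) (h : IsBranch b n s t F) {β γ : ℝ} (hβ : β ∈ Icc s t)
    (hγ : γ ∈ Icc s t) (hle : β ≤ γ) : b * (F γ - F β) ≤ γ * F γ - β * F β := by
  have h1 := (h.strictMonoOn hb).monotoneOn hβ hγ hle
  have h2 := (h.mem_Icc hb hβ).1
  have h3 : (b : ℝ) ≤ γ := h.le_left.trans hγ.1
  nlinarith [mul_nonneg (sub_nonneg.2 h3) (sub_nonneg.2 h1), mul_nonneg (sub_nonneg.2 hle) h2]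

theorem mul_sub_mul_le (hb : 0 < b) (h : IsBranch b n s t F) {β γ : ℝ} (hβ : β ∈ Icc s t)
    (hγ : γ ∈ Icc s t) (hle : β ≤ γ) :
    γ * F γ - β * F β ≤ (((b : ℝ) + 1) ^ (n + 1) - 1) * (γ - β) := by
  have h1 := (h.strictMonoOn hb).monotoneOn hβ hγ hle
  have h2 := (h.mem_Icc hb hβ).2
  have h3 : γ ≤ b + 1 := hγ.2.trans h.right_le
  have h4 := h.sub_le β hβ γ hγ hle
  have hb' : (1 : ℝ) ≤ b := by exact_mod_cast hb
  have h5 : γ * (F γ - F β) ≤ (b + 1) * ((((b : ℝ) + 1) ^ n - 1) * (γ - β)) :=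
    (mul_le_mul_of_nonneg_right h3 (sub_nonneg.2 h1)).trans
      (mul_le_mul_of_nonneg_left h4 (by positivity))
  have h6 : (γ - β) * F β ≤ b * (γ - β) := by
    nlinarith [mul_nonneg (sub_nonneg.2 hle) (sub_nonneg.2 h2),
      mul_nonneg (sub_nonneg.2 hle) (sub_nonneg.2 hb')]
  rw [pow_succ]
  nlinarith

theorem strictMonoOn_mul (hb : 0 < b) (h : IsBranch b n s t F) :
    StrictMonoOn (fun β => β * F β) (Icc s t) := by
  intro β hβ γ hγ hlt
  have h1 := h.strictMonoOn hb hβ hγ hlt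
  have hb' : (0 : ℝ) < b := by exact_mod_cast hb
  exact sub_pos.1 ((mul_pos hb' (sub_pos.2 h1)).trans_le (h.mul_sub_le_mul hb hβ hγ hlt.le))

/-- Where the next digit is `d`, the branch continues by `β ↦ β F β - d`. -/
theorem child (hb : 0 < b) (h : IsBranch b n s t F) {p q : ℝ} (hsp : s ≤ p) (hpq : p < q)
    (hqt : q ≤ t) {d : ℤ} (hp : (d : ℝ) ≤ p * F p) (hq : q * F q ≤ d + 1) :
    IsBranch b (n + 1) p q (fun β => β * F β - d) := by
  have hsub : Icc p q ⊆ Icc s t := Icc_subset_Icc hsp hqt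
  refine ⟨h.le_left.trans hsp, hpq, hqt.trans h.right_le,
    (h.continuousOn_mul.mono hsub).sub continuousOn_const, ?_, sub_nonneg.2 hp, by linarith, ?_, ?_⟩
  · intro β hβ
    have hβ' := hsub ⟨hβ.1, hβ.2.le⟩
    have h1 : p * F p ≤ β * F β :=
      (h.strictMonoOn_mul hb).monotoneOn (hsub ⟨le_rfl, hpq.le⟩) hβ' hβ.1
    have h2 : β * F β < q * F q :=
      h.strictMonoOn_mul hb hβ' (hsub ⟨hpq.le, le_rfl⟩) hβ.2
    have hfl : ⌊β * F β⌋ = d := Int.floor_eq_iff.2 ⟨hp.trans h1, h2.trans_le hq⟩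
    rw [Function.iterate_succ_apply', h.orbit β ⟨hsp.trans hβ.1, hβ.2.trans_le hqt⟩, betaMap, hfl]
  · intro β hβ γ hγ hle
    have h1 := h.expands β (hsub hβ) γ (hsub hγ) hle
    have h2 := h.mul_sub_le_mul hb (hsub hβ) (hsub hγ) hle
    have hb' : (0 : ℝ) < b := by exact_mod_cast hb
    rw [pow_succ]
    nlinarith [mul_le_mul_of_nonneg_left (h1.trans h2) hb'.le]
  · intro β hβ γ hγ hle
    have := h.mul_sub_mul_le hb (hsub hβ) (hsub hγ) hle
    linarith

/-- If `β F β` passes an integer `d` at `p` and rises far enough above it, then the digit `d`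
starts a branch at `p` whose values begin at `0`. -/
theorem exists_child_of_eq (hb : 0 < b) (h : IsBranch b n s t F) {p : ℝ} (hp : p ∈ Icc s t) {d : ℤ}
    (hpd : p * F p = d) (hpt : (d : ℝ) < t * F t) :
    ∃ q ∈ Icc p t, IsBranch b (n + 1) p q (fun β => β * F β - d) ∧
      q * F q = min (t * F t) (d + 1) := by
  have hc : ContinuousOn (fun β => β * F β) (Icc p t) :=
    h.continuousOn_mul.mono (Icc_subset_Icc_left hp.1)
  obtain ⟨q, hq, hqe⟩ := intermediate_value_Icc hp.2 hc
    (show min (t * F t) (d + 1) ∈ Icc (p * F p) (t * F t) from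
      ⟨le_min (hpd.le.trans hpt.le) (by linarith), min_le_left _ _⟩)
  have hqe : q * F q = min (t * F t) (d + 1) := hqe
  have hlt : p < q := by
    refine lt_of_le_of_ne hq.1 ?_
    rintro rfl
    have : (d : ℝ) < min (t * F t) (d + 1) := lt_min hpt (by linarith)
    linarith
  exact ⟨q, hq, h.child hb hp.1 hlt hq.2 hpd.ge (hqe.le.trans (min_le_right _ _)), hqe⟩

/-- A branch whose image has length at least `(N + 1) b⁻ᴺ` contains a full branch `N` levels
further down. Induction on `N`: multiplying by `β` stretches the image by a factor `b`. If the new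
image contains no integer, one digit is removed and nothing is lost. Otherwise it is cut at an
integer: a right part of length `b⁻ᴺ` starts at `0` after removing the digit, and then digits `0`
lead to a full branch, while a shorter right part costs only one unit of `b⁻ᴺ`. -/
theorem exists_isFullBranch (hb : 0 < b) (N : ℕ) (h : IsBranch b n s t F)
    (hN : (N : ℝ) + 1 ≤ (b : ℝ) ^ N * (F t - F s) ∨ F s = 0 ∧ 1 ≤ (b : ℝ) ^ N * F t) :
    ∃ p q G, s ≤ p ∧ q ≤ t ∧ IsFullBranch b (n + N) p q G := by
  have hb' : (0 : ℝ) < b := by exact_mod_cast hb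
  induction N generalizing n s t F with
  | zero =>
    refine ⟨s, t, F, le_rfl, le_rfl, h, ?_⟩
    have h0 := h.nonneg_left
    have h1 := h.right_le_one
    simp only [CharP.cast_eq_zero, pow_zero, one_mul] at hN
    constructor <;> rcases hN with hN | hN <;> linarith
  | succ N ih =>
    have hpow : (0 : ℝ) < (b : ℝ) ^ N := pow_pos hb' N
    have hone : (1 : ℝ) ≤ (b : ℝ) ^ N := one_le_pow₀ (by exact_mod_cast hb)
    have hlift : ∀ {s' t' : ℝ} {F' : ℝ → ℝ}, IsBranch b (n + 1) s' t' F' → s ≤ s' → t' ≤ t →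
        ((N : ℝ) + 1 ≤ (b : ℝ) ^ N * (F' t' - F' s') ∨ F' s' = 0 ∧ 1 ≤ (b : ℝ) ^ N * F' t') →
        ∃ p q G, s ≤ p ∧ q ≤ t ∧ IsFullBranch b (n + (N + 1)) p q G := by
      intro s' t' F' h' hs ht hsize
      obtain ⟨p, q, G, hp, hq, hG⟩ := ih h' hsize
      exact ⟨p, q, G, hs.trans hp, hq.trans ht, by rwa [Nat.add_right_comm, Nat.add_assoc] at hG⟩
    have hzero : ∀ {p : ℝ} {d : ℤ}, p ∈ Icc s t → p * F p = d → 1 ≤ (b : ℝ) ^ N * (t * F t - d) →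
        ∃ p q G, s ≤ p ∧ q ≤ t ∧ IsFullBranch b (n + (N + 1)) p q G := by
      intro p d hp hpd hsize
      have hpt : (d : ℝ) < t * F t := by
        by_contra! hle
        have := mul_nonpos_of_nonneg_of_nonpos hpow.le (sub_nonpos.2 hle)
        linarith
      obtain ⟨q, hq, hbr, hqe⟩ := h.exists_child_of_eq hb hp hpd hpt
      refine hlift hbr hp.1 hq.2 (Or.inr ⟨by linarith, ?_⟩)
      rw [hqe]
      rcases min_choice (t * F t) (d + 1 : ℝ) with he | he <;> rw [he]
      · exact hsize
      · rwa [add_sub_cancel_left, mul_one]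
    have hstretch := h.mul_sub_le_mul hb h.left_mem h.right_mem h.lt.le
    rcases hN with hN | ⟨hs0, hN⟩
    · have hsize : (N : ℝ) + 2 ≤ (b : ℝ) ^ N * (t * F t - s * F s) := by
        have := mul_le_mul_of_nonneg_left hstretch hpow.le
        rw [pow_succ] at hN
        push_cast at hN
        linarith
      set d : ℤ := ⌈s * F s⌉ with hd
      have hd1 : s * F s ≤ d := Int.le_ceil _
      have hd2 : (d : ℝ) < s * F s + 1 := Int.ceil_lt_add_one _
      have hdm : (((d - 1 : ℤ)) : ℝ) = d - 1 := by push_cast; ring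
      by_cases htd : t * F t ≤ d
      · have hbr := h.child hb le_rfl h.lt le_rfl (d := d - 1) (by rw [hdm]; linarith)
          (by rw [hdm]; linarith)
        refine hlift hbr le_rfl le_rfl (Or.inl ?_)
        rw [sub_sub_sub_cancel_right]
        linarith
      · push Not at htd
        obtain ⟨p, hp, hpd⟩ := intermediate_value_Icc h.lt.le h.continuousOn_mul
          (show (d : ℝ) ∈ Icc (s * F s) (t * F t) from ⟨hd1, htd.le⟩)
        have hpd : p * F p = d := hpd
        by_cases hright : 1 ≤ (b : ℝ) ^ N * (t * F t - d)
        · exact hzero hp hpd hright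
        · push Not at hright
          have hleft : (N : ℝ) + 1 ≤ (b : ℝ) ^ N * (d - s * F s) := by
            have : (b : ℝ) ^ N * (t * F t - s * F s) =
              (b : ℝ) ^ N * (t * F t - d) + (b : ℝ) ^ N * (d - s * F s) := by ring
            linarith
          have hsp : s < p := by
            refine lt_of_le_of_ne hp.1 ?_
            rintro rfl
            rw [hpd, sub_self, mul_zero] at hleft
            have : (0 : ℝ) ≤ N := N.cast_nonneg
            linarith
          have hbr := h.child hb le_rfl hsp hp.2 (d := d - 1) (by rw [hdm]; linarith)
            (by rw [hdm]; linarith)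
          refine hlift hbr le_rfl hp.2 (Or.inl ?_)
          rw [sub_sub_sub_cancel_right, hpd]
          exact hleft
    · refine hzero (d := 0) h.left_mem (by simp [hs0]) ?_
      rw [hs0, sub_zero, mul_zero, sub_zero] at hstretch
      have := mul_le_mul_of_nonneg_left hstretch hpow.le
      rw [pow_succ] at hN
      push_cast
      linarith

end IsBranch

namespace IsFullBranch

variable {b n : ℕ} {s t : ℝ} {F : ℝ → ℝ}

/-- A full branch has a full child for each digit `d ≤ b - 1`. -/
theorem exists_child (hb : 0 < b) (h : IsFullBranch b n s t F) {d : ℕ} (hd : d + 1 ≤ b) :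
    ∃ p q, s ≤ p ∧ q ≤ t ∧ p * F p = d ∧ q * F q = d + 1 ∧
      IsFullBranch b (n + 1) p q (fun β => β * F β - d) := by
  obtain ⟨hbr, hs, ht⟩ := h
  have htb : (d : ℝ) + 1 ≤ t * F t := by
    rw [ht, mul_one]
    have : (d : ℝ) + 1 ≤ b := by exact_mod_cast hd
    linarith [hbr.le_left, hbr.lt]
  obtain ⟨p, hp, hpd⟩ := intermediate_value_Icc hbr.lt.le hbr.continuousOn_mul
    (show (d : ℝ) ∈ Icc (s * F s) (t * F t) from ⟨by rw [hs, mul_zero]; positivity, by linarith⟩)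
  have hpd : p * F p = d := hpd
  obtain ⟨q, hq, hch, hqe⟩ := hbr.exists_child_of_eq hb hp (d := d) (by simpa using hpd)
    (by push_cast; linarith)
  have hqe' : q * F q = d + 1 := by rw [hqe]; push_cast; exact min_eq_right htb
  refine ⟨p, q, hp.1, hq.2, hpd, hqe', ?_, ?_, ?_⟩
  · simpa using hch
  · simp [hpd]
  · simp [hqe']

/-- In a full branch `β F β` runs through `[0, t]` with `t ≥ b`, so parameters whose next digits
differ by at least `2` are separated. -/
theorem inv_pow_le_sub (hb : 0 < b) (h : IsBranch b n s t F) {β γ : ℝ} (hβ : β ∈ Icc s t)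
    (hγ : γ ∈ Icc s t) (hβγ : β * F β + 1 ≤ γ * F γ) : (((b : ℝ) + 1) ^ (n + 1))⁻¹ ≤ γ - β := by
  have hle : β ≤ γ := by
    by_contra! hlt
    have : γ * F γ < β * F β := h.strictMonoOn_mul hb hγ hβ hlt
    linarith
  have h1 := h.mul_sub_mul_le hb hβ hγ hle
  rw [inv_le_iff_one_le_mul₀ (by positivity)]
  nlinarith

/-- In a full branch of sufficiently high level, some full branch `N` levels further down consists
of parameters whose orbit point of time `n` is within `β ^ (-k)` of the target. -/
theorem exists_isFullBranch_near (hb : 2 ≤ b) (h : IsFullBranch b n s t F) {x : ℝ → ℝ} {L : ℝ≥0}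
    (hx01 : ∀ β ∈ Ioi (1 : ℝ), x β ∈ Icc (0 : ℝ) 1) (hx : LipschitzOnWith L x (Ioi 1))
    (hL : (b : ℝ) * L ≤ (b : ℝ) ^ n) {k N : ℕ}
    (hN : 4 * ((N : ℝ) + 1) * ((b : ℝ) + 1) ^ k ≤ (b : ℝ) ^ N) :
    ∃ p q G, s ≤ p ∧ q ≤ t ∧ IsFullBranch b (n + N) p q G ∧
      ∀ β ∈ Ico p q, |(betaMap β)^[n] 1 - x β| < β ^ (-(k : ℤ)) := by
  obtain ⟨hbr, hs, ht⟩ := h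
  have hb0 : 0 < b := by omega
  have hb2 : (2 : ℝ) ≤ b := by exact_mod_cast hb
  have hone : ∀ β ∈ Icc s t, β ∈ Ioi (1 : ℝ) := fun β hβ =>
    show (1 : ℝ) < β by linarith [hbr.le_left, hβ.1]
  have hmono := (hbr.strictMonoOn hb0).monotoneOn
  have hxc : ContinuousOn x (Icc s t) := hx.continuousOn.mono hone
  -- A parameter that hits the target exactly.
  obtain ⟨c, hc, hce⟩ := intermediate_value_Icc hbr.lt.le (hbr.continuousOn.sub hxc)
    (show (0 : ℝ) ∈ Icc (F s - x s) (F t - x t) from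
      ⟨by rw [hs]; linarith [(hx01 s (hone s hbr.left_mem)).1],
        by rw [ht]; linarith [(hx01 t (hone t hbr.right_mem)).2]⟩)
  have hce : F c - x c = 0 := hce
  have hcF := hbr.mem_Icc hb0 hc
  set δ : ℝ := (4 * ((b : ℝ) + 1) ^ k)⁻¹ with hδ
  have hpk : (1 : ℝ) ≤ ((b : ℝ) + 1) ^ k := one_le_pow₀ (by linarith)
  have hδ0 : 0 < δ := by positivity
  have hδ4 : δ ≤ 1 / 4 := by
    rw [hδ, one_div]
    exact inv_anti₀ (by norm_num) (by linarith)
  -- Solving for the values `F c ± δ`, cut off at `0` and `1`, leaves an image of length at least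
  -- `δ` on one of the two sides of `F c`.
  obtain ⟨u, hu, hue⟩ := intermediate_value_Icc hbr.lt.le hbr.continuousOn
    (show max 0 (F c - δ) ∈ Icc (F s) (F t) from
      ⟨hs.le.trans (le_max_left _ _), by rw [ht]; exact max_le (by norm_num) (by linarith [hcF.2])⟩)
  obtain ⟨v, hv, hve⟩ := intermediate_value_Icc hbr.lt.le hbr.continuousOn
    (show min 1 (F c + δ) ∈ Icc (F s) (F t) from
      ⟨by rw [hs]; exact le_min (by norm_num) (by linarith [hcF.1]), (min_le_left _ _).trans ht.ge⟩)
  have hlen : δ ≤ F v - F u := by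
    rw [hue, hve]
    rcases le_total (F c) (1 / 2) with hhalf | hhalf
    · rw [min_eq_right (by linarith)]
      have : max 0 (F c - δ) ≤ F c := max_le hcF.1 (by linarith)
      linarith
    · rw [max_eq_right (by linarith)]
      have : F c ≤ min 1 (F c + δ) := le_min hcF.2 (by linarith)
      linarith
  have huv : u < v := by
    by_contra! hle
    have := hmono hv hu hle
    linarith
  have hsub : Icc u v ⊆ Icc s t := Icc_subset_Icc hu.1 hv.2
  have hbr' : IsBranch b n u v F :=
    ⟨hbr.le_left.trans hu.1, huv, hv.2.trans hbr.right_le, hbr.continuousOn.mono hsub,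
      fun β hβ => hbr.orbit β ⟨hu.1.trans hβ.1, hβ.2.trans_le hv.2⟩, (hbr.mem_Icc hb0 hu).1,
      (hbr.mem_Icc hb0 hv).2, fun β hβ γ hγ => hbr.expands β (hsub hβ) γ (hsub hγ),
      fun β hβ γ hγ => hbr.sub_le β (hsub hβ) γ (hsub hγ)⟩
  obtain ⟨p, q, G, hp, hq, hG⟩ := hbr'.exists_isFullBranch hb0 N (Or.inl (by
    have h1 : (b : ℝ) ^ N * δ ≤ (b : ℝ) ^ N * (F v - F u) := by gcongr
    refine le_trans ?_ h1
    rw [hδ, ← div_eq_mul_inv, le_div_iff₀ (by positivity)]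
    linarith))
  refine ⟨p, q, G, hu.1.trans hp, hq.trans hv.2, hG, fun β hβ => ?_⟩
  have hβuv : β ∈ Icc u v := ⟨hp.trans hβ.1, hβ.2.le.trans hq⟩
  have hβ' := hsub hβuv
  rw [hbr'.orbit β ⟨hβuv.1, hβ.2.trans_le hq⟩]
  have hFβ : |F β - F c| ≤ δ := by
    have h1 := hmono hu hβ' hβuv.1
    have h2 := hmono hβ' hv hβuv.2
    rw [hue] at h1
    rw [hve] at h2
    have h3 := le_max_right 0 (F c - δ)
    have h4 := min_le_right 1 (F c + δ)
    rw [abs_le]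
    constructor <;> linarith
  -- The target moves less than the branch does.
  have hxβ : |x β - x c| ≤ |F β - F c| := by
    have hslope : ∀ β ∈ Icc s t, ∀ γ ∈ Icc s t, β ≤ γ → L * (γ - β) ≤ F γ - F β := by
      intro β hβ γ hγ hle
      have h1 := hbr.expands β hβ γ hγ hle
      have h2 := mul_le_mul_of_nonneg_right hL (sub_nonneg.2 hle)
      rw [mul_assoc] at h2
      exact le_of_mul_le_mul_left (h2.trans h1) (by linarith)
    have h1 := hx.dist_le_mul β (hone β hβ') c (hone c hc)
    rw [Real.dist_eq, Real.dist_eq] at h1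
    refine h1.trans ?_
    rcases le_total β c with hle | hle
    · rw [abs_sub_comm, abs_of_nonneg (sub_nonneg.2 hle), abs_sub_comm]
      exact (hslope β hβ' c hc hle).trans (le_abs_self _)
    · rw [abs_of_nonneg (sub_nonneg.2 hle)]
      exact (hslope c hc β hβ' hle).trans (le_abs_self _)
  have hfin : |F β - x β| ≤ 2 * δ := by
    have : F β - x β = (F β - F c) - (x β - x c) := by linarith
    rw [this]
    exact (abs_sub _ _).trans (by linarith)
  have hβ1 : (1 : ℝ) < β := hone β hβ'
  calc |F β - x β| ≤ 2 * δ := hfin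
    _ < 4 * δ := by linarith
    _ = (((b : ℝ) + 1) ^ k)⁻¹ := by rw [hδ, mul_inv]; ring
    _ ≤ (β ^ k)⁻¹ := inv_anti₀ (by positivity)
        (pow_le_pow_left₀ (by linarith) (hβ'.2.trans hbr.right_le) k)
    _ = β ^ (-(k : ℤ)) := by rw [zpow_neg, zpow_natCast]

end IsFullBranch

/-! ### Dimension of a set coded by digits -/

/-- The intervals of a nested scheme along a digit sequence, given the choice `p`, `q` of children's
end points. -/
noncomputable def schemeInterval {m : ℕ} (p q : ℕ → ℝ × ℝ → Fin m → ℝ) (I₀ : ℝ × ℝ)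
    (e : ℕ → Fin m) : ℕ → ℝ × ℝ
  | 0 => I₀
  | i + 1 => (p i (schemeInterval p q I₀ e i) (e i), q i (schemeInterval p q I₀ e i) (e i))

theorem schemeInterval_congr {m : ℕ} (p q : ℕ → ℝ × ℝ → Fin m → ℝ) (I₀ : ℝ × ℝ)
    {e e' : ℕ → Fin m} {i : ℕ} (h : ∀ j < i, e j = e' j) :
    schemeInterval p q I₀ e i = schemeInterval p q I₀ e' i := by
  induction i with
  | zero => rfl
  | succ i ih =>
    simp only [schemeInterval]
    rw [ih fun j hj => h j (by omega), h i (by omega)]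

/-- A scheme of nested intervals in which every interval of generation `i` has `m` children at
mutual distance at least `δ i` carries a set of dimension at least `r`, provided
`m ^ (-i) ≤ C (δ i) ^ r`: sending a point to the number with its digits in base `m` is an
`r`-Hölder map onto `[0, 1)`. Children stay away from the right end point of their parent, so that
properties of half-open intervals pass to the limit points. -/
theorem exists_le_dimH_of_scheme {m : ℕ} (hm : 2 ≤ m) {Q : ℕ → ℝ × ℝ → Prop} {R : ℕ → ℝ → Prop}
    {δ : ℕ → ℝ} {C r : ℝ≥0} (hr : 0 < r) {I₀ : ℝ × ℝ} (h₀ : Q 0 I₀)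
    (hQ : ∀ i I, Q i I → I.1 ≤ I.2)
    (hstep : ∀ i I, Q i I → ∃ p q : Fin m → ℝ,
      (∀ d, I.1 ≤ p d ∧ q d < I.2 ∧ Q (i + 1) (p d, q d) ∧ ∀ β ∈ Ico (p d) (q d), R i β) ∧
      ∀ d d', d ≠ d' → ∀ β ∈ Icc (p d) (q d), ∀ γ ∈ Icc (p d') (q d'), δ i ≤ |β - γ|)
    (hδ0 : ∀ i, 0 ≤ δ i) (hδ : ∀ i, ((m : ℝ) ^ i)⁻¹ ≤ C * δ i ^ (r : ℝ)) :
    ∃ S : Set ℝ, (∀ β ∈ S, ∀ i, R i β) ∧ r ≤ dimH S := by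
  have hstep' : ∀ i I, ∃ p q : Fin m → ℝ, Q i I →
      (∀ d, I.1 ≤ p d ∧ q d < I.2 ∧ Q (i + 1) (p d, q d) ∧ ∀ β ∈ Ico (p d) (q d), R i β) ∧
      ∀ d d', d ≠ d' → ∀ β ∈ Icc (p d) (q d), ∀ γ ∈ Icc (p d') (q d'), δ i ≤ |β - γ| := by
    intro i I
    by_cases h : Q i I
    · obtain ⟨p, q, hpq⟩ := hstep i I h
      exact ⟨p, q, fun _ => hpq⟩
    · exact ⟨0, 0, fun h' => absurd h' h⟩
  choose p q hpq using hstep'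
  set J : (ℕ → Fin m) → ℕ → ℝ × ℝ := schemeInterval p q I₀ with hJ
  have hJQ : ∀ e i, Q i (J e i) := by
    intro e i
    induction i with
    | zero => exact h₀
    | succ i ih => exact ((hpq i _ ih).1 (e i)).2.2.1
  have hJsub : ∀ e i, (J e i).1 ≤ (J e (i + 1)).1 ∧ (J e (i + 1)).2 < (J e i).2 ∧
      ∀ β ∈ Ico (J e (i + 1)).1 (J e (i + 1)).2, R i β := by
    intro e i
    have h := (hpq i _ (hJQ e i)).1 (e i)
    exact ⟨h.1, h.2.1, h.2.2.2⟩
  set pt : (ℕ → Fin m) → ℝ := fun e => ⨆ i, (J e i).1 with hpt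
  have hptmem : ∀ e i, pt e ∈ Icc (J e i).1 (J e i).2 := by
    intro e
    have hanti : Antitone fun i => Icc (J e i).1 (J e i).2 :=
      antitone_nat_of_succ_le fun i => Icc_subset_Icc (hJsub e i).1 (hJsub e i).2.1.le
    exact mem_iInter.1 (ciSup_mem_iInter_Icc_of_antitone_Icc hanti fun i => hQ i _ (hJQ e i))
  have hsep : ∀ e e' i, (∀ j < i, e j = e' j) → e i ≠ e' i → δ i ≤ |pt e - pt e'| := by
    intro e e' i hlt hne
    have h1 := hptmem e (i + 1)
    have h2 := hptmem e' (i + 1)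
    have hc : J e i = J e' i := schemeInterval_congr p q I₀ hlt
    simp only [hJ, schemeInterval] at h1 h2
    rw [← hJ, ← hc] at h2
    exact (hpq i _ (hJQ e i)).2 _ _ hne _ h1 _ h2
  have hne : NeZero m := ⟨by omega⟩
  set g : ℝ → ℝ := fun y => pt (Real.digits y m) with hg
  have hhol : ∀ y ∈ Ico (0 : ℝ) 1, ∀ z ∈ Ico (0 : ℝ) 1, |y - z| ≤ C * |g y - g z| ^ (r : ℝ) := by
    intro y hy z hz
    by_cases heq : Real.digits y m = Real.digits z m
    · have : y = z := by
        rw [← Real.ofDigits_digits (by omega : 1 < m) hy, heq, Real.ofDigits_digits (by omega) hz]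
      rw [this, sub_self, abs_zero]
      positivity
    · have hex : ∃ i, Real.digits y m i ≠ Real.digits z m i := Function.ne_iff.1 heq
      classical
      have hmin : ∀ j < Nat.find hex, Real.digits y m j = Real.digits z m j := fun j hj =>
        not_not.1 (Nat.find_min hex hj)
      have h1 := Real.abs_ofDigits_sub_ofDigits_le hmin
      rw [Real.ofDigits_digits (by omega) hy, Real.ofDigits_digits (by omega) hz] at h1
      have h2 := hsep _ _ _ hmin (Nat.find_spec hex)
      refine h1.trans ((hδ _).trans ?_)
      gcongr
      exact hδ0 _
  have hinj : InjOn g (Ico 0 1) := by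
    intro y hy z hz hyz
    have h := hhol y hy z hz
    rw [hyz, sub_self, abs_zero, Real.zero_rpow (by exact_mod_cast hr.ne'), mul_zero] at h
    exact sub_eq_zero.1 (abs_nonpos_iff.1 h)
  refine ⟨g '' Ico 0 1, ?_, ?_⟩
  · rintro _ ⟨y, -, rfl⟩ i
    set e := Real.digits y m
    exact (hJsub e i).2.2 _ ⟨(hptmem e (i + 1)).1,
      (hptmem e (i + 2)).2.trans_lt (hJsub e (i + 1)).2.1⟩
  · have hf : HolderOnWith C r (Function.invFunOn g (Ico 0 1)) (g '' Ico 0 1) := by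
      rintro _ ⟨y, hy, rfl⟩ _ ⟨z, hz, rfl⟩
      rw [hinj.leftInvOn_invFunOn hy, hinj.leftInvOn_invFunOn hz, edist_dist, edist_dist,
        ENNReal.ofReal_rpow_of_nonneg dist_nonneg r.coe_nonneg, ← ENNReal.ofReal_coe_nnreal,
        ← ENNReal.ofReal_mul C.coe_nonneg]
      exact ENNReal.ofReal_le_ofReal (hhol y hy z hz)
    have h1 := hf.dimH_image_le hr
    rw [hinj.leftInvOn_invFunOn.image_image] at h1
    have h2 : dimH (Ico (0 : ℝ) 1) = 1 := by
      rw [Real.dimH_of_nonempty_interior (by simp [interior_Ico])]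
      simp
    rw [h2, ENNReal.le_div_iff_mul_le (by simp [hr.ne']) (by simp), one_mul] at h1
    exact h1

/-! ### The lower bound -/

open Classical in
/-- Levels of the branches in the construction. After the `i`-th free digit, at time
`n = P i + 1`, a block of `N n` further digits is inserted to approach the target if the time is
`good` and the level stays below `A (i + 1)`. -/
noncomputable def branchLevel (good : ℕ → Prop) (N : ℕ → ℕ) (A : ℝ) : ℕ → ℕ
  | 0 => 1
  | i + 1 =>
    let n := branchLevel good N A i + 1
    if good n ∧ ((n + N n : ℕ) : ℝ) ≤ A * (i + 1) then n + N n else n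

section branchLevel

variable {good : ℕ → Prop} {N : ℕ → ℕ} {A : ℝ}

theorem branchLevel_succ_of_good {i : ℕ} (h : good (branchLevel good N A i + 1))
    (hA : ((branchLevel good N A i + 1 + N (branchLevel good N A i + 1) : ℕ) : ℝ) ≤ A * (i + 1)) :
    branchLevel good N A (i + 1) =
      branchLevel good N A i + 1 + N (branchLevel good N A i + 1) := by
  rw [branchLevel]
  exact if_pos ⟨h, hA⟩

theorem branchLevel_succ_of_not {i : ℕ} (h : ¬(good (branchLevel good N A i + 1) ∧
    ((branchLevel good N A i + 1 + N (branchLevel good N A i + 1) : ℕ) : ℝ) ≤ A * (i + 1))) :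
    branchLevel good N A (i + 1) = branchLevel good N A i + 1 := by
  rw [branchLevel]
  exact if_neg h

theorem branchLevel_strictMono : StrictMono (branchLevel good N A) := by
  refine strictMono_nat_of_lt_succ fun i => ?_
  by_cases h : good (branchLevel good N A i + 1) ∧
    ((branchLevel good N A i + 1 + N (branchLevel good N A i + 1) : ℕ) : ℝ) ≤ A * (i + 1)
  · rw [branchLevel_succ_of_good h.1 h.2]; omega
  · rw [branchLevel_succ_of_not h]; omega

theorem branchLevel_le (hA : 1 ≤ A) (i : ℕ) : (branchLevel good N A i : ℝ) ≤ A * i + 1 := by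
  induction i with
  | zero => simp [branchLevel]
  | succ i ih =>
    by_cases h : good (branchLevel good N A i + 1) ∧
      ((branchLevel good N A i + 1 + N (branchLevel good N A i + 1) : ℕ) : ℝ) ≤ A * (i + 1)
    · rw [branchLevel_succ_of_good h.1 h.2]
      refine h.2.trans ?_
      push_cast
      linarith
    · rw [branchLevel_succ_of_not h]
      push_cast
      linarith

/-- Blocks are inserted infinitely often: otherwise the level is eventually a translation of the
number of free digits, and runs through all large times, some of which admit a block. -/
theorem frequently_block (hgood : ∀ᶠ n in atTop, good n)
    (hfreq : ∀ c : ℝ, ∃ᶠ n : ℕ in atTop, (n : ℝ) + N n ≤ A * (n - c)) (hA : 1 ≤ A) :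
    ∃ᶠ i in atTop, good (branchLevel good N A i + 1) ∧
      ((branchLevel good N A i + 1 + N (branchLevel good N A i + 1) : ℕ) : ℝ) ≤ A * (i + 1) := by
  by_contra hno
  rw [not_frequently] at hno
  obtain ⟨i₀, hi₀⟩ := eventually_atTop.1 hno
  set P := branchLevel good N A with hP
  have hlin : ∀ k, P (i₀ + k) = P i₀ + k := by
    intro k
    induction k with
    | zero => rfl
    | succ k ih =>
      rw [← add_assoc, hP, branchLevel_succ_of_not (hi₀ (i₀ + k) (by omega)), ← hP, ih, add_assoc]
  obtain ⟨n, hn, hngood, hnP⟩ :=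
    ((hfreq (P i₀)).and_eventually (hgood.and (eventually_ge_atTop (P i₀ + 1)))).exists
  obtain ⟨k, rfl⟩ := Nat.exists_eq_add_of_le hnP
  refine hi₀ (i₀ + k) (by omega) ?_
  rw [hlin, show P i₀ + k + 1 = P i₀ + 1 + k by omega]
  refine ⟨hngood, ?_⟩
  push_cast at hn ⊢
  refine hn.trans (mul_le_mul_of_nonneg_left ?_ (by linarith))
  have : (0 : ℝ) ≤ i₀ := i₀.cast_nonneg
  linarith

end branchLevel

/-- Parameters in `[2m, 2m + 1]` with `m` free digits, all even, and with blocks of length `N n`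
forcing the approximation at suitable times `n`. -/
theorem le_dimH_approxParams_of_blocks {x : ℝ → ℝ} {L : ℝ≥0}
    (hx01 : ∀ β ∈ Ioi (1 : ℝ), x β ∈ Icc (0 : ℝ) 1) (hx : LipschitzOnWith L x (Ioi 1))
    {ℓ N : ℕ → ℕ} {m b : ℕ} (hm : 2 ≤ m) (hbm : b = 2 * m) {A : ℝ} {r : ℝ≥0} (hA : 1 ≤ A)
    (hN : ∀ᶠ n in atTop, 4 * ((N n : ℝ) + 1) * ((b : ℝ) + 1) ^ ℓ n ≤ (b : ℝ) ^ N n)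
    (hfreq : ∀ c : ℝ, ∃ᶠ n : ℕ in atTop, (n : ℝ) + N n ≤ A * (n - c)) (hr : 0 < r)
    (hrA : r * A * Real.log (b + 1) ≤ Real.log m) : r ≤ dimH (approxParams ℓ x) := by
  have hb0 : 0 < b := by omega
  have hb1 : (1 : ℝ) < b := by exact_mod_cast (by omega : 1 < b)
  set good : ℕ → Prop := fun n => 4 * ((N n : ℝ) + 1) * ((b : ℝ) + 1) ^ ℓ n ≤ (b : ℝ) ^ N n ∧
    (b : ℝ) * L ≤ (b : ℝ) ^ n
  have hgood : ∀ᶠ n in atTop, good n :=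
    hN.and ((tendsto_pow_atTop_atTop_of_one_lt hb1).eventually_ge_atTop _)
  set P := branchLevel good N A with hP
  set block : ℕ → Prop := fun i => good (P i + 1) ∧
    ((P i + 1 + N (P i + 1) : ℕ) : ℝ) ≤ A * (i + 1) with hblock
  have hscheme : ∃ S : Set ℝ, (∀ β ∈ S, ∀ i, 1 < β ∧ (block i →
      |(betaMap β)^[P i + 1] 1 - x β| < β ^ (-(ℓ (P i + 1) : ℤ)))) ∧ r ≤ dimH S := by
    refine exists_le_dimH_of_scheme hm (r := r)
      (Q := fun i I => ∃ F, IsFullBranch b (P i) I.1 I.2 F)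
      (δ := fun i => (((b : ℝ) + 1) ^ (P i + 1))⁻¹) (C := ((b : ℝ≥0) + 1) ^ (2 * r : ℝ)) hr
      (I₀ := (b, b + 1)) ⟨_, isFullBranch_one hb0⟩ (fun i I ⟨F, hF⟩ => hF.1.lt.le) ?_
      (fun i => by positivity) ?_
    · rintro i ⟨s, t⟩ ⟨F, hF⟩
      simp only at hF
      have key : ∀ d : Fin m, ∃ p q : ℝ, s ≤ p ∧ q < t ∧ (∃ G, IsFullBranch b (P (i + 1)) p q G) ∧
          (∀ β ∈ Ico p q, 1 < β ∧ (block i →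
            |(betaMap β)^[P i + 1] 1 - x β| < β ^ (-(ℓ (P i + 1) : ℤ)))) ∧
          ∀ β ∈ Icc p q, β * F β ∈ Icc (2 * (d : ℝ)) (2 * d + 1) := by
        intro d
        have hd : 2 * (d : ℕ) + 2 ≤ b := by omega
        obtain ⟨p, q, hsp, hqt, hp, hq, hch⟩ := hF.exists_child hb0 (d := 2 * d) (by omega)
        push_cast at hp hq
        have hd' : 2 * (d : ℝ) + 2 ≤ b := by exact_mod_cast hd
        have hpq := hch.1.lt
        have hqt' : q < t := by
          refine lt_of_le_of_ne hqt ?_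
          rintro rfl
          rw [hF.2.2] at hq
          linarith [hF.1.le_left, hF.1.lt]
        have hdig : ∀ β ∈ Icc p q, β * F β ∈ Icc (2 * (d : ℝ)) (2 * d + 1) := by
          intro β hβ
          have hmono := (hF.1.strictMonoOn_mul hb0).monotoneOn
          have hβ' : β ∈ Icc s t := ⟨hsp.trans hβ.1, hβ.2.trans hqt⟩
          exact ⟨hp.symm.le.trans (hmono ⟨hsp, hpq.le.trans hqt⟩ hβ' hβ.1),
            (hmono hβ' ⟨hsp.trans hpq.le, hqt⟩ hβ.2).trans hq.le⟩
        by_cases hi : block i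
        · obtain ⟨p', q', G, hp', hq', hG, hnear⟩ :=
            hch.exists_isFullBranch_near (by omega) hx01 hx hi.1.2 hi.1.1
          refine ⟨p', q', hsp.trans hp', hq'.trans_lt hqt', ⟨G, ?_⟩, fun β hβ => ⟨?_, fun _ => ?_⟩,
            fun β hβ => hdig β ⟨hp'.trans hβ.1, hβ.2.trans hq'⟩⟩
          · rwa [hP, branchLevel_succ_of_good hi.1 hi.2]
          · linarith [hG.1.le_left, hβ.1]
          · exact hnear β hβ
        · have hlevel : P (i + 1) = P i + 1 := branchLevel_succ_of_not hi
          refine ⟨p, q, hsp, hqt', by rw [hlevel]; exact ⟨_, hch⟩,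
            fun β hβ => ⟨?_, fun h => absurd h hi⟩, hdig⟩
          linarith [hch.1.le_left, hβ.1]
      choose p q hsp hqt hG hR hdig using key
      refine ⟨p, q, fun d => ⟨hsp d, hqt d, hG d, hR d⟩, ?_⟩
      have hmem : ∀ d, ∀ β ∈ Icc (p d) (q d), β ∈ Icc s t := fun d β hβ =>
        ⟨(hsp d).trans hβ.1, hβ.2.trans (hqt d).le⟩
      have hlt : ∀ d d' : Fin m, d < d' → ∀ β ∈ Icc (p d) (q d), ∀ γ ∈ Icc (p d') (q d'),
          (((b : ℝ) + 1) ^ (P i + 1))⁻¹ ≤ γ - β := by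
        intro d d' hdd β hβ γ hγ
        refine IsFullBranch.inv_pow_le_sub hb0 hF.1 (hmem d β hβ) (hmem d' γ hγ) ?_
        have h1 : (d : ℝ) + 1 ≤ d' := by exact_mod_cast hdd
        linarith [(hdig d β hβ).2, (hdig d' γ hγ).1]
      intro d d' hne β hβ γ hγ
      rcases lt_or_gt_of_ne hne with h | h
      · rw [abs_sub_comm]
        exact (hlt d d' h β hβ γ hγ).trans (le_abs_self _)
      · exact (hlt d' d h γ hγ β hβ).trans (le_abs_self _)
    · intro i
      have hB : (0 : ℝ) < (b : ℝ) + 1 := by positivity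
      have hm0 : (0 : ℝ) < m := by exact_mod_cast (by omega : 0 < m)
      have hlogB : 0 ≤ Real.log ((b : ℝ) + 1) := Real.log_nonneg (by linarith)
      rw [NNReal.coe_rpow, NNReal.coe_add, NNReal.coe_natCast, NNReal.coe_one, Real.inv_rpow
        (by positivity), ← Real.rpow_natCast ((b : ℝ) + 1), ← Real.rpow_mul hB.le,
        ← Real.rpow_neg hB.le, ← Real.rpow_add hB, ← Real.log_le_log_iff (by positivity)
        (by positivity), Real.log_inv, Real.log_pow, Real.log_rpow hB]
      have hle : (P i : ℝ) ≤ A * i + 1 := branchLevel_le hA i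
      have hr0 : (0 : ℝ) ≤ r := r.coe_nonneg
      have h1 : ((P i + 1 : ℕ) : ℝ) * r - 2 * r ≤ r * A * i := by
        push_cast
        nlinarith [mul_le_mul_of_nonneg_left hle hr0]
      have h2 := mul_le_mul_of_nonneg_right h1 hlogB
      have h3 := mul_le_mul_of_nonneg_left hrA (Nat.cast_nonneg (α := ℝ) i)
      linarith
  obtain ⟨S, hS, hdim⟩ := hscheme
  refine hdim.trans (dimH_mono fun β hβ => ?_)
  refine ⟨(hS β hβ 0).1, ?_⟩
  have hinf := Nat.frequently_atTop_iff_infinite.1 (frequently_block hgood hfreq hA)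
  have hinj : InjOn (fun i => P i + 1) {i | block i} := fun i _ j _ hij =>
    branchLevel_strictMono.injective (Nat.succ_injective hij)
  refine (hinf.image hinj).mono ?_
  rintro _ ⟨i, hi, rfl⟩
  exact ⟨Nat.le_add_left _ _, (hS β hβ i).2 hi⟩

/-- The lower bound. A real `r` below `1 / (1 + α)` leaves room for the three losses of the
construction: restricting the digits to `m` of the roughly `2 m` available ones, blocks longer than
`ℓ n` by a factor `1 + η`, and times `n` at which `ℓ n / n` is only close to `α`. -/
theorem le_dimH_approxParams {x : ℝ → ℝ} {L : ℝ≥0}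
    (hx01 : ∀ β ∈ Ioi (1 : ℝ), x β ∈ Icc (0 : ℝ) 1) (hx : LipschitzOnWith L x (Ioi 1))
    {ℓ : ℕ → ℕ} (hℓ : Tendsto ℓ atTop atTop) :
    1 / (1 + liminf (fun n : ℕ => (ℓ n : ℝ≥0∞) / (n : ℝ≥0∞)) atTop) ≤
      dimH (approxParams ℓ x) := by
  set α := liminf (fun n : ℕ => (ℓ n : ℝ≥0∞) / (n : ℝ≥0∞)) atTop with hα
  refine ENNReal.le_of_forall_nnreal_lt fun r hrα => ?_
  rcases eq_or_ne r 0 with rfl | hr0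
  · simp
  have hr : 0 < r := pos_iff_ne_zero.2 hr0
  have hrR : (0 : ℝ) < r := by exact_mod_cast hr
  have hαtop : α ≠ ∞ := by
    intro h
    rw [h] at hrα
    simp at hrα
  -- Constants `α < a`, `1 + (1 + η) a < A` and `r A < 1`.
  have h1 : (r : ℝ) * (1 + α.toReal) < 1 := by
    have h2 : (r : ℝ≥0∞) * (1 + α) < 1 := by
      rwa [ENNReal.lt_div_iff_mul_lt (by simp) (Or.inr (by exact_mod_cast hr0))] at hrα
    have h3 := (ENNReal.toReal_lt_toReal h2.ne_top ENNReal.one_ne_top).2 h2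
    rwa [ENNReal.toReal_mul, ENNReal.toReal_add ENNReal.one_ne_top hαtop, ENNReal.toReal_one,
      ENNReal.coe_toReal] at h3
  have hα0 : 0 ≤ α.toReal := ENNReal.toReal_nonneg
  obtain ⟨A, hA1, hA2⟩ := exists_between ((lt_div_iff₀' hrR).2 h1)
  have hrA : (r : ℝ) * A < 1 := (lt_div_iff₀' hrR).1 hA2
  obtain ⟨a, ha1, ha2⟩ := exists_between (show α.toReal < A - 1 by linarith)
  have ha0 : 0 < a := hα0.trans_lt ha1
  obtain ⟨η, hη0, hη⟩ : ∃ η : ℝ, 0 < η ∧ 1 + (1 + η) * a < A := by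
    refine ⟨(A - 1 - a) / (2 * a), by apply div_pos <;> linarith, ?_⟩
    have : (A - 1 - a) / (2 * a) * a = (A - 1 - a) / 2 := by field_simp
    linarith
  -- The digit base: `m` is so large that restricting the digits costs little entropy.
  have hmcast : Tendsto (fun m : ℕ => (m : ℝ)) atTop atTop := tendsto_natCast_atTop_atTop
  obtain ⟨m, hm1, hm2, hm3⟩ := (((Real.tendsto_log_atTop.comp hmcast).eventually_ge_atTop
    (r * A * Real.log 3 / (1 - r * A))).and
    ((((tendsto_rpow_atTop hη0).comp hmcast).eventually_ge_atTop 2).and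
      (eventually_ge_atTop 2))).exists
  have hm2 : (2 : ℝ) ≤ (m : ℝ) ^ η := hm2
  have hm1 : r * A * Real.log 3 / (1 - r * A) ≤ Real.log m := hm1
  have hmR : (2 : ℝ) ≤ m := by exact_mod_cast hm3
  set b := 2 * m with hb
  have hbR : (b : ℝ) = 2 * m := by rw [hb]; push_cast; ring
  have hb0 : (0 : ℝ) < b := by linarith
  refine le_dimH_approxParams_of_blocks hx01 hx (N := fun n => ⌈(1 + η) * ℓ n⌉₊) hm3 hb
    (A := A) (by linarith) ?_ ?_ hr ?_
  · have hratio : 3 / 2 * ((b : ℝ) + 1) ≤ (b : ℝ) ^ (1 + η) := by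
      have h2 : (m : ℝ) ^ η ≤ (b : ℝ) ^ η :=
        Real.rpow_le_rpow (by linarith) (by linarith) hη0.le
      rw [Real.rpow_add hb0, Real.rpow_one]
      nlinarith [mul_le_mul_of_nonneg_left (hm2.trans h2) hb0.le]
    set K : ℝ := 4 * (1 + η) + 8 with hK
    have hK0 : 0 < K := by linarith
    have hlim := tendsto_pow_const_div_const_pow_of_one_lt 1 (show (1 : ℝ) < 3 / 2 by norm_num)
    have hev : ∀ᶠ k : ℕ in atTop, K * k ≤ (3 / 2 : ℝ) ^ k := by
      filter_upwards [hlim.eventually (eventually_lt_nhds (inv_pos.2 hK0))] with k hk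
      rw [pow_one, div_lt_iff₀ (by positivity), ← div_eq_inv_mul, lt_div_iff₀ hK0] at hk
      linarith
    filter_upwards [hℓ.eventually hev, hℓ.eventually (eventually_ge_atTop 1)] with n hn hn1
    have hn1' : (1 : ℝ) ≤ ℓ n := by exact_mod_cast hn1
    have hceil : (⌈(1 + η) * ℓ n⌉₊ : ℝ) < (1 + η) * ℓ n + 1 := Nat.ceil_lt_add_one (by positivity)
    calc 4 * ((⌈(1 + η) * ℓ n⌉₊ : ℝ) + 1) * ((b : ℝ) + 1) ^ ℓ n
        ≤ (3 / 2 : ℝ) ^ ℓ n * ((b : ℝ) + 1) ^ ℓ n := by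
          gcongr
          linarith
      _ = (3 / 2 * ((b : ℝ) + 1)) ^ ℓ n := by rw [mul_pow]
      _ ≤ ((b : ℝ) ^ (1 + η)) ^ ℓ n := by gcongr
      _ = (b : ℝ) ^ ((1 + η) * ℓ n) := by rw [← Real.rpow_natCast, ← Real.rpow_mul hb0.le]
      _ ≤ (b : ℝ) ^ (⌈(1 + η) * ℓ n⌉₊ : ℝ) :=
          Real.rpow_le_rpow_of_exponent_le (by linarith) (Nat.le_ceil _)
      _ = (b : ℝ) ^ ⌈(1 + η) * ℓ n⌉₊ := Real.rpow_natCast _ _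
  · intro c
    have hlt : α < ENNReal.ofReal a := (ENNReal.lt_ofReal_iff_toReal_lt hαtop).2 ha1
    have hlarge : ∀ᶠ n : ℕ in atTop, 1 + A * c ≤ (A - (1 + (1 + η) * a)) * n :=
      (hmcast.const_mul_atTop (by linarith)).eventually_ge_atTop _
    refine ((frequently_lt_of_liminf_lt (by isBoundedDefault) hlt).and_eventually
      (hlarge.and (eventually_gt_atTop 0))).mono ?_
    rintro n ⟨hn, hnl, hn0⟩
    have hn0' : (0 : ℝ) < n := by exact_mod_cast hn0
    have hle : (ℓ n : ℝ) ≤ a * n := by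
      rw [ENNReal.div_lt_iff (Or.inl (by exact_mod_cast hn0.ne')) (Or.inl (by simp)),
        ← ENNReal.ofReal_natCast n, ← ENNReal.ofReal_mul ha0.le, ← ENNReal.ofReal_natCast (ℓ n),
        ENNReal.ofReal_lt_ofReal_iff (by positivity)] at hn
      exact hn.le
    have hceil : (⌈(1 + η) * ℓ n⌉₊ : ℝ) < (1 + η) * ℓ n + 1 := Nat.ceil_lt_add_one (by positivity)
    have := mul_le_mul_of_nonneg_left hle (show 0 ≤ 1 + η by linarith)
    linarith
  · have hlog : Real.log ((b : ℝ) + 1) ≤ Real.log 3 + Real.log m := by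
      rw [← Real.log_mul (by norm_num) (by positivity)]
      exact Real.log_le_log (by positivity) (by linarith)
    rw [div_le_iff₀ (by linarith)] at hm1
    have h2 := mul_le_mul_of_nonneg_left hlog (show 0 ≤ r * A by
      exact mul_nonneg hrR.le (by linarith))
    linarith

/-- The lower limit `liminf ℓ_n / n` is taken in `[0, ∞]`, and `1 / (1 + ∞) = 0`. -/
theorem theorem1p2 (x : ℝ → ℝ) (hx01 : ∀ β ∈ Ioi (1 : ℝ), x β ∈ Icc (0 : ℝ) 1)
    (hxLip : ∃ L : ℝ≥0, LipschitzOnWith L x (Ioi (1 : ℝ)))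
    (ℓ : ℕ → ℕ) (hℓpos : ∀ n, 1 ≤ n → 0 < ℓ n) (hℓ : Tendsto ℓ atTop atTop) :
    dimH (approxParams ℓ x) =
      1 / (1 + liminf (fun n : ℕ => (ℓ n : ℝ≥0∞) / (n : ℝ≥0∞)) atTop) := by
  obtain ⟨L, hL⟩ := hxLip
  exact le_antisymm (dimH_approxParams_le hL ℓ) (le_dimH_approxParams hx01 hL hℓ)
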